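/- Consider a control system $\dot y=f(y,u)$ a.e., $y(0)=x$, with measurable controls $u$ taking values a.e. in $\mathcal U=[-1,1]^M$, of one of the following two types: (a) linear: $f(x,u)=Ax+Bu$ on $\mathbb R^N$, with $A\in\mathbb R^{N\times N}$ and $B\in\mathbb R^{N\times M}$; (b) planar, control-affine: $f(x,u)=F(x)+\sum_{i=1}^M u_i\,g_i(x)$ on $\mathbb R^2$ ($N=2$), where $F,g_1,\dots,g_M:\mathbb R^2\to\mathbb R^2$ are of class $C^1$ with Lipschitz continuous differentials. Let $T(x)\in[0,+\infty]$ be the minimum time to reach the origin from $x$, i.e. the infimum of the times $t\ge0$ such that, for some control $u$, there is a (Carathéodory) solution on $[0,t]$ that starts at $x$ and is at the origin at time $t$ ($T(x)=+\infty$ if there is none). Set $\mathcal R_t=\{x:T(x)\le t\}$ and $h(x,\zeta)=\min_{u\in\mathcal U}\langle\zeta,f(x,u)\rangle$. For $K\subset\mathbb R^d$ and $x\in K$ let $N_K(x)$ be the set of proximal normals to $K$ at $x$: all $v$ for which there is $\sigma\ge0$ with $\langle v,y-x\rangle\le\sigma\|y-x\|^2$ for all $y\in K$. A locally closed set $K$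 has (locally) positive reach if there is a continuous $\varphi:K\to[0,\infty)$ such that $\langle v,y-x\rangle\le\varphi(x)\|v\|\,\|y-x\|^2$ for all $x,y\in K$ and $v\in N_K(x)$. If $T(x)<+\infty$, let $\partial^\infty T(x)$ be the set of all $v\in\mathbb R^N$ with $(v,0)\in N_{\mathrm{epi}(T)}(x,T(x))$, where $\mathrm{epi}(T)=\{(x,\beta)\in\mathbb R^N\times\mathbb R:\beta\ge T(x)\}$. Let $\bar x\ne0$ with $T(\bar x)<+\infty$, and let $D$ be a neighbourhood of $\bar x$ (for instance a closed ball $\bar B(\bar x,\delta)$, $\delta>0$) such that the epigraph $\{(x,\beta)\in D\times\mathbb R:\beta\ge T(x)\}$ of $T$ restricted to $D$ has positive reach. Then, for every $\zeta\in\mathbb R^N$ with $\zeta\neq0$, $$\zeta\in\partial^\infty T(\bar x)\quad\Longleftrightarrow\quad h(\bar x,\zeta)=0\ \text{ and }\ \zeta\in N_{\mathcal R_{T(\bar x)}}(\bar x).$$ -/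

import Mathlib

open Set MeasureTheory Topology
open scoped NNReal

noncomputable section

namespace MinTime

/-! ### Proximal normals, positive reach, epigraphs -/

section NonsmoothAnalysis

variable {H : Type*} [NormedAddCommGroup H] [InnerProductSpace ℝ H]

/-- The cone `N_K(x)` of proximal normals to `K` at a point `x ∈ K` (empty when `x ∉ K`):
`⟨v, y - x⟩ ≤ σ ‖y - x‖ ^ 2` for all `y ∈ K`, for some `σ ≥ 0` depending on `v` and `x`. -/
def proximalNormals (K : Set H) (x : H) : Set H :=
  {v | x ∈ K ∧ ∃ σ : ℝ, 0 ≤ σ ∧ ∀ y ∈ K, inner ℝ v (y - x) ≤ σ * ‖y - x‖ ^ 2}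

/-- `K` is locally closed and there is a continuous `φ : K → [0, ∞)` with
`⟨v, y - x⟩ ≤ φ(x) ‖v‖ ‖y - x‖ ^ 2` for all `x, y ∈ K` and `v ∈ N_K(x)`. -/
def HasLocallyPositiveReach (K : Set H) : Prop :=
  IsLocallyClosed K ∧
    ∃ φ : H → ℝ, ContinuousOn φ K ∧ (∀ x ∈ K, 0 ≤ φ x) ∧
      ∀ x ∈ K, ∀ y ∈ K, ∀ v ∈ proximalNormals K x,
        inner ℝ v (y - x) ≤ φ x * ‖v‖ * ‖y - x‖ ^ 2

/-- The epigraph `{(x, β) : x ∈ D, β ≥ T(x)}` of the restriction of `T` to `D`, as a subset of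
`H × ℝ` with its Euclidean structure. -/
def epigraphOn (D : Set H) (T : H → EReal) : Set (WithLp 2 (H × ℝ)) :=
  {p | p.fst ∈ D ∧ T p.fst ≤ (p.snd : EReal)}

/-- The horizon subdifferential `∂^∞ T(x)`: all `v` such that `(v, 0)` is a proximal normal to
`epi(T)` at `(x, T(x))`.  It is meant for functions `T` with values in `(-∞, +∞]` and for points
`x` with `T(x) < +∞`. -/
def horizonSubdifferential (T : H → EReal) (x : H) : Set H :=
  {v | WithLp.toLp 2 (v, (0 : ℝ)) ∈
    proximalNormals (epigraphOn univ T) (WithLp.toLp 2 (x, (T x).toReal))}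

end NonsmoothAnalysis

/-! ### Control systems `y' = f(y, u)`, `u ∈ [-1, 1] ^ M` -/

section Control

variable {N M : ℕ}

/-- The control set `[-1, 1] ^ M`. -/
def controlSet (M : ℕ) : Set (Fin M → ℝ) := {w | ∀ i, w i ∈ Icc (-1 : ℝ) 1}

/-- Admissible controls: measurable, with values in `[-1, 1] ^ M` almost everywhere. -/
def IsAdmissible (u : ℝ → Fin M → ℝ) : Prop :=
  Measurable u ∧ ∀ᵐ s : ℝ, u s ∈ controlSet M

/-- `y` is a Carathéodory solution on `[0, t]` of `y' = f(y, u)`, `y(0) = x`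
(in integral form). -/
def IsTrajectory (f : EuclideanSpace ℝ (Fin N) → (Fin M → ℝ) → EuclideanSpace ℝ (Fin N))
    (u : ℝ → Fin M → ℝ) (x : EuclideanSpace ℝ (Fin N)) (t : ℝ)
    (y : ℝ → EuclideanSpace ℝ (Fin N)) : Prop :=
  ContinuousOn y (Icc 0 t) ∧
    IntervalIntegrable (fun r => f (y r) (u r)) volume 0 t ∧
    ∀ s ∈ Icc 0 t, y s = x + ∫ r in (0 : ℝ)..s, f (y r) (u r)

/-- Some admissible control steers `x` to the origin in time `t`. -/
def SteersToOrigin (f : EuclideanSpace ℝ (Fin N) → (Fin M → ℝ) → EuclideanSpace ℝ (Fin N))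
    (x : EuclideanSpace ℝ (Fin N)) (t : ℝ) : Prop :=
  0 ≤ t ∧ ∃ (u : ℝ → Fin M → ℝ) (y : ℝ → EuclideanSpace ℝ (Fin N)),
    IsAdmissible u ∧ IsTrajectory f u x t y ∧ y t = 0

/-- The minimum time `T(x) ∈ [0, +∞]` to reach the origin from `x` (`+∞` if the origin cannot be
reached): the infimum, over all admissible controls, of the times at which the trajectory starting
from `x` is at the origin. -/
def minTime (f : EuclideanSpace ℝ (Fin N) → (Fin M → ℝ) → EuclideanSpace ℝ (Fin N))
    (x : EuclideanSpace ℝ (Fin N)) : EReal :=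
  sInf {τ : EReal | ∃ t : ℝ, SteersToOrigin f x t ∧ τ = (t : EReal)}

/-- The sublevel `R_t = {x : T(x) ≤ t}` of the minimum time function. -/
def reachableSet (f : EuclideanSpace ℝ (Fin N) → (Fin M → ℝ) → EuclideanSpace ℝ (Fin N))
    (t : EReal) : Set (EuclideanSpace ℝ (Fin N)) :=
  {x | minTime f x ≤ t}

/-- The minimized Hamiltonian `h(x, p) = min {⟨p, f(x, w)⟩ : w ∈ [-1, 1] ^ M}`
(for `f` continuous in the control, the infimum is a minimum over a nonempty compact set). -/
def minHamiltonian (f : EuclideanSpace ℝ (Fin N) → (Fin M → ℝ) → EuclideanSpace ℝ (Fin N))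
    (x p : EuclideanSpace ℝ (Fin N)) : ℝ :=
  sInf ((fun w => inner ℝ p (f x w)) '' controlSet M)

/-- The linear dynamics `f(x, u) = A x + B u`. -/
def linearDynamics (A : Matrix (Fin N) (Fin N) ℝ) (B : Matrix (Fin N) (Fin M) ℝ)
    (x : EuclideanSpace ℝ (Fin N)) (w : Fin M → ℝ) : EuclideanSpace ℝ (Fin N) :=
  WithLp.toLp 2 (A.mulVec x.ofLp + B.mulVec w)

/-- The control-affine dynamics `f(x, u) = F(x) + G(x) u = F(x) + ∑ i, u i • g i (x)`, where
the `g i` are the columns of `G`. -/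
def affineDynamics (F : EuclideanSpace ℝ (Fin N) → EuclideanSpace ℝ (Fin N))
    (g : Fin M → EuclideanSpace ℝ (Fin N) → EuclideanSpace ℝ (Fin N))
    (x : EuclideanSpace ℝ (Fin N)) (w : Fin M → ℝ) : EuclideanSpace ℝ (Fin N) :=
  F x + ∑ i, w i • g i x

/-- `F` is of class `C^{1,1}`, with derivative globally Lipschitz with constant `L`. -/
def IsC11 (L : ℝ≥0) (F : EuclideanSpace ℝ (Fin N) → EuclideanSpace ℝ (Fin N)) : Prop :=
  ContDiff ℝ 1 F ∧ LipschitzWith L (fderiv ℝ F)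

end Control

end MinTime

end

namespace MinTime

variable {N M : ℕ} {f : EuclideanSpace ℝ (Fin N) → (Fin M → ℝ) → EuclideanSpace ℝ (Fin N)}

/-! ### Elementary properties of the minimum time function -/

/-! The argument works for any dynamics that is `C¹` in the state for each fixed control, with
bounds and a Lipschitz estimate near `x₀` uniform in the control. Write `r = T(x₀)`. If `(ζ, 0)` is
normal to the epigraph, the slice `β = r` makes `ζ` normal to `R_r`. Running a constant control `w`
backward from `x₀` for time `s` gives epigraph points at height `r + s`; first order in `s` yields
`⟨ζ, f(x₀, w)⟩ ≥ 0`, so `h ≥ 0`. Conversely, a nearly optimal trajectory from `x₀` enters `R_r`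
after a short time, and normality to `R_r` then gives `h ≤ 0`. For the other direction, a nearby `y`
with `T(y) ≤ β` is carried into `R_r` in time `O(β - r)`; since `h = 0`, this lowers the pairing
with `ζ` by at most a second-order amount. Nearly optimal trajectories suffice throughout, so no
optimal control is needed. -/

lemma minTime_nonneg (x : EuclideanSpace ℝ (Fin N)) : 0 ≤ minTime f x := by
  refine le_sInf ?_
  rintro _ ⟨t, ht, rfl⟩
  exact_mod_cast ht.1

lemma minTime_le_of_steersToOrigin {x : EuclideanSpace ℝ (Fin N)} {t : ℝ}
    (h : SteersToOrigin f x t) : minTime f x ≤ (t : EReal) :=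
  sInf_le ⟨t, h, rfl⟩

lemma exists_steersToOrigin_lt {x : EuclideanSpace ℝ (Fin N)} {c : ℝ}
    (h : minTime f x < (c : EReal)) : ∃ t : ℝ, SteersToOrigin f x t ∧ t < c := by
  obtain ⟨_, ⟨t, ht, rfl⟩, hlt⟩ := sInf_lt_iff.1 h
  exact ⟨t, ht, by exact_mod_cast hlt⟩

lemma coe_toReal_minTime {x : EuclideanSpace ℝ (Fin N)} (h : minTime f x < ⊤) :
    ((minTime f x).toReal : EReal) = minTime f x :=
  EReal.coe_toReal h.ne (ne_of_gt (lt_of_lt_of_le EReal.bot_lt_zero (minTime_nonneg x)))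

lemma integral_congr_uIoc {E : Type*} [NormedAddCommGroup E] [NormedSpace ℝ E] {F G : ℝ → E}
    {a b : ℝ} (h : EqOn F G (uIoc a b)) : ∫ r in a..b, F r = ∫ r in a..b, G r :=
  intervalIntegral.integral_congr_ae (Filter.Eventually.of_forall fun _ hr => h hr)

/-! ### Restriction and concatenation of trajectories -/

namespace IsTrajectory

variable {u : ℝ → Fin M → ℝ} {x : EuclideanSpace ℝ (Fin N)} {t : ℝ}
  {y : ℝ → EuclideanSpace ℝ (Fin N)}

lemma intervalIntegrable_sub (h : IsTrajectory f u x t y) {a b : ℝ} (ha : a ∈ Icc 0 t)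
    (hb : b ∈ Icc 0 t) : IntervalIntegrable (fun r => f (y r) (u r)) volume a b := by
  refine h.2.1.mono_set ?_
  rw [uIcc_of_le (ha.1.trans ha.2)]
  exact uIcc_subset_Icc ha hb

lemma sub_eq_integral (h : IsTrajectory f u x t y) {a b : ℝ} (ha : a ∈ Icc 0 t)
    (hb : b ∈ Icc 0 t) : y b - y a = ∫ r in a..b, f (y r) (u r) := by
  have h0 : (0 : ℝ) ∈ Icc 0 t := ⟨le_rfl, ha.1.trans ha.2⟩
  rw [h.2.2 b hb, h.2.2 a ha, add_sub_add_left_eq_sub]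
  exact intervalIntegral.integral_interval_sub_left (h.intervalIntegrable_sub h0 hb)
    (h.intervalIntegrable_sub h0 ha)

lemma apply_zero (h : IsTrajectory f u x t y) (ht : 0 ≤ t) : y 0 = x := by
  simpa using h.2.2 0 ⟨le_rfl, ht⟩

/-- The continuity of a trajectory follows from the integral equation. -/
lemma of_integral_eq (ht : 0 ≤ t)
    (hi : IntervalIntegrable (fun r => f (y r) (u r)) volume 0 t)
    (h : ∀ s ∈ Icc 0 t, y s = x + ∫ r in (0 : ℝ)..s, f (y r) (u r)) :
    IsTrajectory f u x t y := by
  refine ⟨?_, hi, h⟩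
  have hc := intervalIntegral.continuousOn_primitive_interval' hi left_mem_uIcc
  rw [uIcc_of_le ht] at hc
  exact (continuousOn_const.add hc).congr h

lemma shift (h : IsTrajectory f u x t y) {s : ℝ} (hs : s ∈ Icc 0 t) :
    IsTrajectory f (fun r => u (r + s)) (y s) (t - s) (fun r => y (r + s)) := by
  refine of_integral_eq (sub_nonneg.2 hs.2) ?_ fun r hr => ?_
  · have := (h.intervalIntegrable_sub hs ⟨hs.1.trans hs.2, le_rfl⟩).comp_add_right s
    simpa using this
  · rw [intervalIntegral.integral_comp_add_right (fun r => f (y r) (u r)) s, zero_add,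
      ← h.sub_eq_integral hs ⟨by linarith [hr.1, hs.1], by linarith [hr.2]⟩]
    abel

lemma concat {u₁ u₂ : ℝ → Fin M → ℝ} {y₁ y₂ : ℝ → EuclideanSpace ℝ (Fin N)} {s : ℝ}
    (hs : 0 ≤ s) (ht : 0 ≤ t) (h₁ : IsTrajectory f u₁ x s y₁)
    (h₂ : IsTrajectory f u₂ (y₁ s) t y₂) :
    IsTrajectory f (fun r => if r ≤ s then u₁ r else u₂ (r - s)) x (s + t)
      (fun r => if r ≤ s then y₁ r else y₂ (r - s)) := by
  set F : ℝ → EuclideanSpace ℝ (Fin N) := fun r =>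
    f (if r ≤ s then y₁ r else y₂ (r - s)) (if r ≤ s then u₁ r else u₂ (r - s)) with hF
  have hF₁ : ∀ b ≤ s, 0 ≤ b → EqOn (fun r => f (y₁ r) (u₁ r)) F (uIoc 0 b) := by
    intro b hb hb0 r hr
    rw [uIoc_of_le hb0] at hr
    have : r ≤ s := hr.2.trans hb
    simp [hF, this]
  have hF₂ : ∀ b, s ≤ b → EqOn (fun r => f (y₂ (r - s)) (u₂ (r - s))) F (uIoc s b) := by
    intro b hb r hr
    rw [uIoc_of_le hb] at hr
    simp [hF, not_le.2 hr.1]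
  have hi₁ : IntervalIntegrable F volume 0 s := h₁.2.1.congr (hF₁ s le_rfl hs)
  have hi₂ : IntervalIntegrable F volume s (s + t) := by
    refine IntervalIntegrable.congr (hF₂ (s + t) (by linarith)) ?_
    have := h₂.2.1.comp_sub_right s
    simpa [add_comm] using this
  refine of_integral_eq (add_nonneg hs ht) (hi₁.trans hi₂) fun r hr => ?_
  change (if r ≤ s then y₁ r else y₂ (r - s)) = x + ∫ r in (0 : ℝ)..r, F r
  by_cases hrs : r ≤ s
  · rw [if_pos hrs, h₁.2.2 r ⟨hr.1, hrs⟩]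
    congr 1
    exact integral_congr_uIoc (hF₁ r hrs hr.1)
  · rw [if_neg hrs]
    have hsr : s ≤ r := (not_le.1 hrs).le
    have hi₃ : IntervalIntegrable F volume s r := hi₂.mono_set (by
      rw [uIcc_of_le hsr, uIcc_of_le (by linarith)]; exact Icc_subset_Icc_right hr.2)
    rw [← intervalIntegral.integral_add_adjacent_intervals hi₁ hi₃,
      ← integral_congr_uIoc (hF₁ s le_rfl hs),
      ← integral_congr_uIoc (hF₂ r hsr), ← add_assoc,
      ← h₁.2.2 s ⟨hs, le_rfl⟩,
      intervalIntegral.integral_comp_sub_right (fun r => f (y₂ r) (u₂ r)) s, sub_self,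
      h₂.2.2 (r - s) ⟨by linarith, by linarith [hr.2]⟩]

end IsTrajectory

lemma SteersToOrigin.of_isTrajectory {u : ℝ → Fin M → ℝ} {x : EuclideanSpace ℝ (Fin N)} {t s : ℝ}
    {y : ℝ → EuclideanSpace ℝ (Fin N)} (hu : IsAdmissible u) (h : IsTrajectory f u x t y)
    (hy : y t = 0) (hs : s ∈ Icc 0 t) : SteersToOrigin f (y s) (t - s) := by
  refine ⟨sub_nonneg.2 hs.2, fun r => u (r + s), fun r => y (r + s), ⟨?_, ?_⟩, h.shift hs, ?_⟩
  · exact hu.1.comp (measurable_id.add_const s)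
  · exact (measurePreserving_add_right volume s).quasiMeasurePreserving.ae hu.2
  · simpa using hy

lemma SteersToOrigin.prepend {u : ℝ → Fin M → ℝ} {x : EuclideanSpace ℝ (Fin N)} {t s : ℝ}
    {y : ℝ → EuclideanSpace ℝ (Fin N)} (hs : 0 ≤ s) (hu : IsAdmissible u)
    (h : IsTrajectory f u x s y) (h' : SteersToOrigin f (y s) t) :
    SteersToOrigin f x (s + t) := by
  obtain ⟨ht, u₂, y₂, hu₂, hy₂, h0⟩ := h'
  refine ⟨add_nonneg hs ht, _, _, ⟨?_, ?_⟩, h.concat hs ht hy₂, ?_⟩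
  · exact Measurable.ite measurableSet_Iic hu.1 (hu₂.1.comp (measurable_id.sub_const s))
  · have := (measurePreserving_sub_right volume s).quasiMeasurePreserving.ae hu₂.2
    filter_upwards [hu.2, this] with r h1 h2
    split_ifs
    · exact h1
    · exact h2
  -- The concatenation takes its first branch at `r = s`, so `t = 0` is the case where the endpoint
  -- is read off `y` instead of `y₂`.
  · rcases ht.eq_or_lt with rfl | ht
    · have := hy₂.apply_zero le_rfl
      simp only [add_zero, le_refl, if_true]
      rw [← this, h0]
    · simp [not_le.2 ht, h0]

/-! ### Local estimates -/

/-- Local bounds for the dynamics around `x₀`, uniform in the control. -/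
structure HasLocalBounds
    (f : EuclideanSpace ℝ (Fin N) → (Fin M → ℝ) → EuclideanSpace ℝ (Fin N))
    (x₀ : EuclideanSpace ℝ (Fin N)) (δ C K : ℝ) : Prop where
  radius_pos : 0 < δ
  bound_nonneg : 0 ≤ C
  lip_nonneg : 0 ≤ K
  norm_le : ∀ x ∈ Metric.closedBall x₀ δ, ∀ w ∈ controlSet M, ‖f x w‖ ≤ C
  norm_sub_le : ∀ x ∈ Metric.closedBall x₀ δ, ∀ w ∈ controlSet M,
    ‖f x w - f x₀ w‖ ≤ K * ‖x - x₀‖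

lemma zero_mem_controlSet : (0 : Fin M → ℝ) ∈ controlSet M := fun i => by simp

namespace HasLocalBounds

variable {x₀ : EuclideanSpace ℝ (Fin N)} {δ C K : ℝ}

lemma minHamiltonian_le (hf : HasLocalBounds f x₀ δ C K) (ζ : EuclideanSpace ℝ (Fin N))
    {w : Fin M → ℝ} (hw : w ∈ controlSet M) : minHamiltonian f x₀ ζ ≤ inner ℝ ζ (f x₀ w) := by
  refine csInf_le ⟨-(‖ζ‖ * C), ?_⟩ ⟨w, hw, rfl⟩
  rintro _ ⟨v, hv, rfl⟩
  refine (neg_le_neg ?_).trans (neg_le_of_abs_le (abs_real_inner_le_norm ζ (f x₀ v)))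
  exact mul_le_mul_of_nonneg_left
    (hf.norm_le x₀ (Metric.mem_closedBall_self hf.radius_pos.le) v hv) (norm_nonneg _)

variable {u : ℝ → Fin M → ℝ} {x : EuclideanSpace ℝ (Fin N)} {t s : ℝ}
  {y : ℝ → EuclideanSpace ℝ (Fin N)}

/-- Trajectories starting near `x₀` have speed at most `C` for small times. -/
lemma norm_sub_le_of_isTrajectory (hf : HasLocalBounds f x₀ δ C K) (hu : IsAdmissible u)
    (h : IsTrajectory f u x t y) (hs : s ∈ Icc 0 t) (hδ : ‖x - x₀‖ + C * s < δ) :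
    ∀ r ∈ Icc 0 s, ‖y r - x‖ ≤ C * r := by
  have hst : Icc 0 s ⊆ Icc 0 t := Icc_subset_Icc_right hs.2
  have hcont : ContinuousOn y (Icc 0 s) := h.1.mono hst
  -- Continuous induction: the bound up to `r` keeps `y r` strictly inside the ball, so the speed
  -- bound holds a little longer.
  refine IsClosed.Icc_subset_of_forall_mem_nhdsWithin (s := {r | ‖y r - x‖ ≤ C * r}) ?_ ?_ ?_
  · rw [inter_comm]
    exact isClosed_Icc.isClosed_le (hcont.sub continuousOn_const).norm
      (continuousOn_const.mul continuousOn_id)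
  · simp [h.apply_zero (hs.1.trans hs.2)]
  · rintro r ⟨hr, hr0, hrs⟩
    have hr_lt : ‖y r - x₀‖ < δ := by
      calc ‖y r - x₀‖ ≤ ‖y r - x‖ + ‖x - x₀‖ := norm_sub_le_norm_sub_add_norm_sub _ _ _
        _ ≤ C * r + ‖x - x₀‖ := by gcongr; exact hr
        _ ≤ C * s + ‖x - x₀‖ := by have := hf.bound_nonneg; gcongr
        _ < δ := by linarith
    have hev : ∀ᶠ b in 𝓝[≥] r, ‖y b - x₀‖ < δ := by
      have hc : ContinuousWithinAt (fun b => ‖y b - x₀‖) (Ici r) r := by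
        have : ContinuousWithinAt y (Icc r s) r :=
          (hcont r ⟨hr0, hrs.le⟩).mono (Icc_subset_Icc_left hr0)
        exact ((this.mono_of_mem_nhdsWithin (Icc_mem_nhdsGE hrs)).sub
          continuousWithinAt_const).norm
      exact hc.eventually_lt continuousWithinAt_const hr_lt
    obtain ⟨c, hrc, hc⟩ := mem_nhdsGE_iff_exists_Ico_subset.1 hev
    filter_upwards [Ioo_mem_nhdsGT (lt_min hrc hrs)] with b hb
    have hbc : b < c := hb.2.trans_le (min_le_left _ _)
    have hbs : b < s := hb.2.trans_le (min_le_right _ _)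
    have hinc := h.sub_eq_integral (hst ⟨hr0, hrs.le⟩) (hst ⟨hr0.trans hb.1.le, hbs.le⟩)
    have hbd : ‖y b - y r‖ ≤ C * |b - r| := by
      rw [hinc]
      refine intervalIntegral.norm_integral_le_of_norm_le_const_ae ?_
      filter_upwards [hu.2] with q hq hqr
      rw [uIoc_of_le hb.1.le] at hqr
      refine hf.norm_le _ ?_ _ hq
      rw [mem_closedBall_iff_norm]
      exact (hc ⟨hqr.1.le, hqr.2.trans_lt hbc⟩ : ‖y q - x₀‖ < δ).le
    rw [abs_of_pos (sub_pos.2 hb.1)] at hbd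
    have hr' : ‖y r - x‖ ≤ C * r := hr
    calc ‖y b - x‖ ≤ ‖y b - y r‖ + ‖y r - x‖ := norm_sub_le_norm_sub_add_norm_sub _ _ _
      _ ≤ C * (b - r) + C * r := add_le_add hbd hr'
      _ = C * b := by ring

/-- Lower bound for the displacement along a short trajectory in terms of the minimized
Hamiltonian. -/
lemma le_inner_sub_of_isTrajectory (hf : HasLocalBounds f x₀ δ C K) (hu : IsAdmissible u)
    (h : IsTrajectory f u x t y) (hs : s ∈ Icc 0 t) (hδ : ‖x - x₀‖ + C * s < δ)
    (ζ : EuclideanSpace ℝ (Fin N)) :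
    s * (minHamiltonian f x₀ ζ - K * ‖ζ‖ * (‖x - x₀‖ + C * s)) ≤ inner ℝ ζ (y s - x) := by
  have h0t : (0 : ℝ) ∈ Icc 0 t := ⟨le_rfl, hs.1.trans hs.2⟩
  have hi := h.intervalIntegrable_sub h0t hs
  have heq : inner ℝ ζ (y s - x) = ∫ r in (0 : ℝ)..s, inner ℝ ζ (f (y r) (u r)) := by
    rw [h.2.2 s hs, add_sub_cancel_left]
    exact ((innerSL ℝ ζ).intervalIntegral_comp_comm hi).symm
  have hi' : IntervalIntegrable (fun r => inner ℝ ζ (f (y r) (u r))) volume 0 s :=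
    ⟨(innerSL ℝ ζ).integrable_comp hi.1, (innerSL ℝ ζ).integrable_comp hi.2⟩
  rw [heq]
  set c := minHamiltonian f x₀ ζ - K * ‖ζ‖ * (‖x - x₀‖ + C * s)
  have hconst : s * c = ∫ _ in (0 : ℝ)..s, c := by simp
  rw [hconst]
  refine intervalIntegral.integral_mono_ae_restrict hs.1 intervalIntegrable_const hi' ?_
  rw [Filter.EventuallyLE, ae_restrict_iff' measurableSet_Icc]
  filter_upwards [hu.2] with r hur hr
  have hyr : ‖y r - x₀‖ ≤ ‖x - x₀‖ + C * s := by
    calc ‖y r - x₀‖ ≤ ‖y r - x‖ + ‖x - x₀‖ := norm_sub_le_norm_sub_add_norm_sub _ _ _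
      _ ≤ C * r + ‖x - x₀‖ := by
        gcongr; exact hf.norm_sub_le_of_isTrajectory hu h hs hδ r hr
      _ ≤ C * s + ‖x - x₀‖ := by have := hf.bound_nonneg; have := hr.2; gcongr
      _ = _ := add_comm _ _
  have hsub := hf.norm_sub_le (y r) (mem_closedBall_iff_norm.2 (hyr.trans hδ.le)) _ hur
  have hin : -(‖ζ‖ * (K * (‖x - x₀‖ + C * s))) ≤ inner ℝ ζ (f (y r) (u r) - f x₀ (u r)) := by
    refine (neg_le_neg ?_).trans (neg_le_of_abs_le (abs_real_inner_le_norm ζ _))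
    have := hf.lip_nonneg
    gcongr
    exact hsub.trans (by gcongr)
  rw [inner_sub_right] at hin
  have := hf.minHamiltonian_le ζ hur
  simp only [c]
  linarith

end HasLocalBounds

/-! ### Horizon subgradients -/

lemma mem_horizonSubdifferential_iff {H : Type*} [NormedAddCommGroup H] [InnerProductSpace ℝ H]
    {T : H → EReal} {x v : H} {r : ℝ} (hr : T x = r) :
    v ∈ horizonSubdifferential T x ↔ ∃ σ : ℝ, 0 ≤ σ ∧ ∀ (y : H) (β : ℝ), T y ≤ β →
      inner ℝ v (y - x) ≤ σ * (‖y - x‖ ^ 2 + (β - r) ^ 2) := by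
  rw [horizonSubdifferential, hr, EReal.toReal_coe]
  constructor
  · rintro ⟨-, σ, hσ, h⟩
    refine ⟨σ, hσ, fun y β hy => ?_⟩
    simpa [WithLp.prod_norm_sq_eq_of_L2, WithLp.prod_inner_apply] using
      h (WithLp.toLp 2 (y, β)) ⟨mem_univ y, hy⟩
  · rintro ⟨σ, hσ, h⟩
    refine ⟨⟨mem_univ x, hr.le⟩, σ, hσ, fun p hp => ?_⟩
    simpa [WithLp.prod_norm_sq_eq_of_L2, WithLp.prod_inner_apply] using h p.fst p.snd hp.2

variable {x₀ ζ : EuclideanSpace ℝ (Fin N)} {δ C K : ℝ}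

/-- The minimum time grows at most at unit rate backwards along trajectories. -/
lemma minTime_le_add {u : ℝ → Fin M → ℝ} {x : EuclideanSpace ℝ (Fin N)} {s r : ℝ}
    {y : ℝ → EuclideanSpace ℝ (Fin N)} (hs : 0 ≤ s) (hu : IsAdmissible u)
    (h : IsTrajectory f u x s y) (hr : minTime f (y s) = r) :
    minTime f x ≤ ((r + s : ℝ) : EReal) := by
  -- The infimum defining `minTime` need not be attained, hence the slack `c > r + s`.
  refine EReal.le_of_forall_lt_iff_le.1 fun c hc => ?_
  have hc' : r + s < c := by exact_mod_cast hc
  obtain ⟨t, ht, htc⟩ := exists_steersToOrigin_lt (f := f) (x := y s) (c := c - s)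
    (by rw [hr]; exact_mod_cast (by linarith : r < c - s))
  refine (minTime_le_of_steersToOrigin (ht.prepend hs hu h)).trans ?_
  exact_mod_cast (by linarith : s + t ≤ c)

/-- Moving backward along a frozen control raises the minimum time at most linearly, so it enters
the normal inequality only through a square. -/
lemma minHamiltonian_nonneg_of_mem_horizonSubdifferential
    (hf : ∀ w ∈ controlSet M, ContDiff ℝ 1 fun x => f x w) (hT : minTime f x₀ < ⊤)
    (hζ : ζ ∈ horizonSubdifferential (minTime f) x₀) : 0 ≤ minHamiltonian f x₀ ζ := by
  have hr := (coe_toReal_minTime hT).symm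
  set r := (minTime f x₀).toReal
  obtain ⟨σ, -, hσ⟩ := (mem_horizonSubdifferential_iff hr).1 hζ
  refine le_csInf (Set.Nonempty.image _ ⟨0, zero_mem_controlSet⟩) ?_
  rintro _ ⟨w, hw, rfl⟩
  -- Picard–Lindelöf for the frozen control `w`, on both sides of time `0`.
  obtain ⟨γ, hγ0, ε, hε, hγ⟩ :=
    (hf w hw).contDiffAt.exists_forall_mem_closedBall_exists_eq_forall_mem_Ioo_hasDerivAt₀
      (x₀ := x₀) 0
  simp only [zero_sub, zero_add] at hγ
  have hback : ∀ s ∈ Ioo 0 ε, minTime f (γ (-s)) ≤ ((r + s : ℝ) : EReal) := by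
    intro s hs
    have hder : ∀ q ∈ Icc 0 s, HasDerivAt (fun q => γ (q - s)) (f (γ (q - s)) w) q := by
      intro q hq
      exact (hγ (q - s) ⟨by linarith [hq.1, hs.2], by linarith [hq.2]⟩).comp_sub_const q s
    have hcont : ContinuousOn (fun q => f (γ (q - s)) w) (Icc 0 s) := fun q hq =>
      (((hf w hw).continuous.continuousAt).comp (hder q hq).continuousAt).continuousWithinAt
    have hint : ∀ b ∈ Icc 0 s, IntervalIntegrable (fun q => f (γ (q - s)) w) volume 0 b :=
      fun b hb => (hcont.mono (by
        rw [uIcc_of_le hb.1]; exact Icc_subset_Icc_right hb.2)).intervalIntegrable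
    refine minTime_le_add (u := fun _ => w) (y := fun q => γ (q - s)) hs.1.le
      ⟨measurable_const, Filter.Eventually.of_forall fun _ => hw⟩ ?_ (by simpa [hγ0] using hr)
    refine IsTrajectory.of_integral_eq hs.1.le (hint s ⟨hs.1.le, le_rfl⟩) fun b hb => ?_
    rw [intervalIntegral.integral_eq_sub_of_hasDerivAt (fun q hq => hder q ?_) (hint b hb)]
    · simp
    · rw [uIcc_of_le hb.1] at hq
      exact ⟨hq.1, hq.2.trans hb.2⟩
  -- `φ` vanishes at `0` and is nonnegative just to its left, so its derivative there is
  -- nonpositive; the squares contribute nothing to it.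
  set φ : ℝ → ℝ := fun q => σ * (‖γ q - x₀‖ ^ 2 + q ^ 2) - inner ℝ ζ (γ q - x₀) with hφ
  have hγ' : HasDerivAt γ (f x₀ w) 0 := by
    simpa [hγ0] using hγ 0 ⟨by linarith, hε⟩
  have hφ' : HasDerivAt φ (-inner ℝ ζ (f x₀ w)) 0 := by
    have h1 := (hγ'.sub_const x₀).norm_sq
    have h2 := (hasDerivAt_pow 2 (0 : ℝ))
    have h3 := (innerSL ℝ ζ).hasFDerivAt.comp_hasDerivAt (0 : ℝ) (hγ'.sub_const x₀)
    refine (((h1.add h2).const_mul σ).sub h3).congr_deriv ?_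
    simp [hγ0]
  have hslope := (hasDerivAt_iff_tendsto_slope_left_right.1 hφ').1
  have hle : -inner ℝ ζ (f x₀ w) ≤ 0 := by
    refine le_of_tendsto hslope ?_
    filter_upwards [Ioo_mem_nhdsLT (show -ε < 0 by linarith)] with q hq
    have hb := hback (-q) ⟨by linarith [hq.2], by linarith [hq.1]⟩
    rw [neg_neg] at hb
    have h1 := hσ (γ q) (r + -q) hb
    have h2 : 0 ≤ φ q := by
      simp only [hφ]
      nlinarith [h1]
    have h3 : φ 0 = 0 := by simp [hφ, hγ0]
    rw [slope_def_field, h3, sub_zero, sub_zero]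
    exact div_nonpos_of_nonneg_of_nonpos h2 hq.2.le
  linarith

lemma minHamiltonian_nonpos_of_mem_proximalNormals (hf : HasLocalBounds f x₀ δ C K)
    (hx₀ : x₀ ≠ 0) (hT : minTime f x₀ < ⊤)
    (hζ : ζ ∈ proximalNormals (reachableSet f (minTime f x₀)) x₀) :
    minHamiltonian f x₀ ζ ≤ 0 := by
  have hr := (coe_toReal_minTime hT).symm
  set r := (minTime f x₀).toReal
  obtain ⟨-, σ, hσ0, hσ⟩ := hζ
  have hC := hf.bound_nonneg
  -- `C * s < ‖x₀‖` prevents arrival at the origin before time `s`. An excess of `s ^ 2` over the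
  -- optimal time is absorbed because `s < 1`, so the trajectory is in the reachable set at time
  -- `s`.
  have key : ∀ s ∈ Ioo (0 : ℝ) 1, C * s < δ → C * s < ‖x₀‖ →
      minHamiltonian f x₀ ζ ≤ (σ * C ^ 2 + K * ‖ζ‖ * C) * s := by
    rintro s ⟨hs0, hs1⟩ hsδ hsx
    obtain ⟨t, ⟨ht, u, y, hu, hy, hy0⟩, htr⟩ := exists_steersToOrigin_lt (f := f) (x := x₀)
      (c := r + s ^ 2) (by rw [hr]; exact_mod_cast (by nlinarith : r < r + s ^ 2))
    have hst : s ≤ t := by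
      by_contra! hts
      have hCt : C * t ≤ C * s := mul_le_mul_of_nonneg_left hts.le hC
      have := hf.norm_sub_le_of_isTrajectory hu hy ⟨ht, le_rfl⟩
        (by simpa using hCt.trans_lt hsδ) t ⟨ht, le_rfl⟩
      rw [hy0, zero_sub, norm_neg] at this
      linarith
    have hs : s ∈ Icc 0 t := ⟨hs0.le, hst⟩
    have hsδ' : ‖x₀ - x₀‖ + C * s < δ := by simpa using hsδ
    have hmem : y s ∈ reachableSet f (minTime f x₀) := by
      refine (minTime_le_of_steersToOrigin (SteersToOrigin.of_isTrajectory hu hy hy0 hs)).trans ?_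
      rw [hr]
      exact_mod_cast (by nlinarith : t - s ≤ r)
    have h1 := hσ _ hmem
    have h2 := hf.le_inner_sub_of_isTrajectory hu hy hs hsδ' ζ
    have h3 := hf.norm_sub_le_of_isTrajectory hu hy hs hsδ' s ⟨hs0.le, le_rfl⟩
    have h4 : σ * ‖y s - x₀‖ ^ 2 ≤ σ * (C * s) ^ 2 := by gcongr
    rw [sub_self, norm_zero, zero_add] at h2
    have h5 : s * minHamiltonian f x₀ ζ ≤ s * ((σ * C ^ 2 + K * ‖ζ‖ * C) * s) := by
      nlinarith
    exact le_of_mul_le_mul_left h5 hs0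
  have hlin : ∀ c : ℝ, Filter.Tendsto (fun s : ℝ => c * s) (𝓝[>] 0) (𝓝 0) := fun c => by
    simpa using ((continuous_const_mul c).tendsto 0).mono_left nhdsWithin_le_nhds
  refine ge_of_tendsto (hlin (σ * C ^ 2 + K * ‖ζ‖ * C)) ?_
  filter_upwards [Ioo_mem_nhdsGT one_pos, (hlin C).eventually_lt_const hf.radius_pos,
    (hlin C).eventually_lt_const (norm_pos_iff.2 hx₀)] with s h1 h2 h3
  exact key s h1 h2 h3

lemma mem_proximalNormals_of_mem_horizonSubdifferential (hT : minTime f x₀ < ⊤)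
    (hζ : ζ ∈ horizonSubdifferential (minTime f) x₀) :
    ζ ∈ proximalNormals (reachableSet f (minTime f x₀)) x₀ := by
  have hr := (coe_toReal_minTime hT).symm
  obtain ⟨σ, hσ0, hσ⟩ := (mem_horizonSubdifferential_iff hr).1 hζ
  refine ⟨le_refl (minTime f x₀), σ, hσ0, fun y hy => ?_⟩
  have hy' : minTime f y ≤ ((minTime f x₀).toReal : EReal) := by rw [← hr]; exact hy
  simpa using hσ y _ hy'

lemma mem_horizonSubdifferential_of_mem_proximalNormals (hf : HasLocalBounds f x₀ δ C K)
    (hT : minTime f x₀ < ⊤) (hh : minHamiltonian f x₀ ζ = 0)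
    (hζ : ζ ∈ proximalNormals (reachableSet f (minTime f x₀)) x₀) :
    ζ ∈ horizonSubdifferential (minTime f) x₀ := by
  have hr := (coe_toReal_minTime hT).symm
  have hr0 : 0 ≤ (minTime f x₀).toReal := EReal.toReal_nonneg (minTime_nonneg x₀)
  set r := (minTime f x₀).toReal
  obtain ⟨-, σ, hσ0, hσ⟩ := hζ
  have hC := hf.bound_nonneg
  have hK := hf.lip_nonneg
  have hδ := hf.radius_pos
  -- From distance below `η`, a trajectory run for time at most `2 * η` stays in the `δ`-ball.
  obtain ⟨η, hη, hηδ⟩ : ∃ η : ℝ, 0 < η ∧ η + 2 * C * η < δ := by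
    refine ⟨δ / (2 * (1 + 2 * C)), by positivity, ?_⟩
    have : δ / (2 * (1 + 2 * C)) + 2 * C * (δ / (2 * (1 + 2 * C))) = δ / 2 := by
      field_simp
    linarith
  have hζ0 := norm_nonneg ζ
  refine (mem_horizonSubdifferential_iff hr).2
    -- The three terms pay for normality at the displaced point, the drift of the Hamiltonian along
    -- the trajectory, and points at distance at least `η` in `y` or `β`.
    ⟨σ * (2 + 8 * C ^ 2) + K * ‖ζ‖ * (1 + 4 * C) + ‖ζ‖ / η, by positivity, fun y β hy => ?_⟩
  set a := ‖y - x₀‖ with ha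
  have ha0 : 0 ≤ a := norm_nonneg _
  have hreach : minTime f y ≤ (r : EReal) → inner ℝ ζ (y - x₀) ≤ σ * a ^ 2 := fun h =>
    hσ y (by rw [reachableSet, mem_ofPred_eq, hr]; exact h)
  obtain ⟨b, hb⟩ : ∃ b, b = β - r := ⟨_, rfl⟩
  rw [← hb]
  have hσle : σ * a ^ 2 ≤
      (σ * (2 + 8 * C ^ 2) + K * ‖ζ‖ * (1 + 4 * C) + ‖ζ‖ / η) * (a ^ 2 + b ^ 2) := by
    have h1 : σ ≤ σ * (2 + 8 * C ^ 2) + K * ‖ζ‖ * (1 + 4 * C) + ‖ζ‖ / η := by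
      have : 0 ≤ K * ‖ζ‖ * (1 + 4 * C) + ‖ζ‖ / η := by positivity
      nlinarith [mul_nonneg hσ0 (sq_nonneg C)]
    have h2 : a ^ 2 ≤ a ^ 2 + b ^ 2 := by nlinarith [sq_nonneg b]
    exact mul_le_mul h1 h2 (by positivity) (hσ0.trans h1)
  rcases le_or_gt b 0 with hb0 | hb0
  · refine (hreach (hy.trans ?_)).trans hσle
    exact_mod_cast (by linarith : β ≤ r)
  by_cases hfar : η ≤ a ∨ η ≤ b
  · have h1 : a * η ≤ a ^ 2 + b ^ 2 := by
      rcases hfar with h | h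
      · nlinarith [sq_nonneg b]
      · nlinarith [sq_nonneg (a - b), mul_le_mul_of_nonneg_left h ha0]
    calc inner ℝ ζ (y - x₀) ≤ ‖ζ‖ * a := real_inner_le_norm _ _
      _ = ‖ζ‖ / η * (a * η) := by field_simp
      _ ≤ ‖ζ‖ / η * (a ^ 2 + b ^ 2) := by gcongr
      _ ≤ _ := by
        gcongr
        have : 0 ≤ σ * (2 + 8 * C ^ 2) + K * ‖ζ‖ * (1 + 4 * C) := by positivity
        linarith
  · obtain ⟨haη, hbη⟩ := not_or.1 hfar
    rw [not_le] at haη hbη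
    -- Slack `b = β - r` keeps the excess `t - r` below `2 * b`; after running for that excess the
    -- remaining time is exactly `r`.
    obtain ⟨t, ht, htβ⟩ := exists_steersToOrigin_lt (f := f) (x := y) (c := β + b)
      (hy.trans_lt (by exact_mod_cast (by linarith : β < β + b)))
    rcases le_or_gt t r with htr | htr
    · refine (hreach ((minTime_le_of_steersToOrigin ht).trans ?_)).trans hσle
      exact_mod_cast htr
    obtain ⟨-, u, z, hu, hz, hz0⟩ := ht
    obtain ⟨s, hs⟩ : ∃ s, s = t - r := ⟨_, rfl⟩
    have hs0 : 0 ≤ s := by linarith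
    have hs2 : s ≤ 2 * b := by linarith
    have hst : s ∈ Icc 0 t := ⟨hs0, by linarith⟩
    have hCs : C * s ≤ 2 * C * b := by nlinarith
    have hsδ : ‖y - x₀‖ + C * s < δ := by
      have : 2 * C * b ≤ 2 * C * η := by gcongr
      linarith
    have hzs : z s ∈ reachableSet f (minTime f x₀) := by
      refine (minTime_le_of_steersToOrigin
        (SteersToOrigin.of_isTrajectory hu hz hz0 hst)).trans ?_
      rw [hr]
      exact_mod_cast (by linarith : t - s ≤ r)
    have h1 := hσ _ hzs
    have h2 := hf.le_inner_sub_of_isTrajectory hu hz hst hsδ ζ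
    have h3 := hf.norm_sub_le_of_isTrajectory hu hz hst hsδ s ⟨hs0, le_rfl⟩
    have h4 : ‖z s - x₀‖ ≤ a + 2 * C * b :=
      (norm_sub_le_norm_sub_add_norm_sub (z s) y x₀).trans (by linarith)
    have h5 : inner ℝ ζ (y - x₀) = inner ℝ ζ (z s - x₀) - inner ℝ ζ (z s - y) := by
      rw [← inner_sub_right]; congr 1; abel
    have h6 : σ * ‖z s - x₀‖ ^ 2 ≤ σ * ((2 + 8 * C ^ 2) * (a ^ 2 + b ^ 2)) := by
      gcongr
      calc ‖z s - x₀‖ ^ 2 ≤ (a + 2 * C * b) ^ 2 := by gcongr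
        _ ≤ (2 + 8 * C ^ 2) * (a ^ 2 + b ^ 2) := by
          nlinarith [sq_nonneg (a - 2 * C * b), sq_nonneg b, mul_nonneg (sq_nonneg C) (sq_nonneg a)]
    have h7 : s * (a + C * s) ≤ (1 + 4 * C) * (a ^ 2 + b ^ 2) := by
      calc s * (a + C * s) ≤ 2 * b * (a + 2 * C * b) := by gcongr
        _ ≤ (1 + 4 * C) * (a ^ 2 + b ^ 2) := by
          nlinarith [sq_nonneg (a - b), mul_nonneg hC (sq_nonneg a)]
    have h8 : K * ‖ζ‖ * (s * (a + C * s)) ≤ K * ‖ζ‖ * ((1 + 4 * C) * (a ^ 2 + b ^ 2)) := by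
      gcongr
    have h9 : 0 ≤ ‖ζ‖ / η * (a ^ 2 + b ^ 2) := by positivity
    rw [hh, ← ha] at h2
    rw [h5]
    have h10 : s * (0 - K * ‖ζ‖ * (a + C * s)) = -(K * ‖ζ‖ * (s * (a + C * s))) := by ring
    rw [h10] at h2
    rw [add_mul, add_mul, mul_assoc σ, mul_assoc (K * ‖ζ‖)]
    linarith

/-- Characterization of the horizon subgradients of the minimum time function by means of the
minimized Hamiltonian and of the proximal normals to the reachable set. -/
theorem mem_horizonSubdifferential_minTime_iff (hb : HasLocalBounds f x₀ δ C K)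
    (hf : ∀ w ∈ controlSet M, ContDiff ℝ 1 fun x => f x w) (hx₀ : x₀ ≠ 0)
    (hT : minTime f x₀ < ⊤) :
    ζ ∈ horizonSubdifferential (minTime f) x₀ ↔
      minHamiltonian f x₀ ζ = 0 ∧ ζ ∈ proximalNormals (reachableSet f (minTime f x₀)) x₀ := by
  refine ⟨fun h => ?_, fun h => mem_horizonSubdifferential_of_mem_proximalNormals hb hT h.1 h.2⟩
  have hN := mem_proximalNormals_of_mem_horizonSubdifferential hT h
  exact ⟨le_antisymm (minHamiltonian_nonpos_of_mem_proximalNormals hb hx₀ hT hN)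
    (minHamiltonian_nonneg_of_mem_horizonSubdifferential hf hT h), hN⟩

/-! ### Control-affine and linear dynamics -/

lemma norm_sum_smul_le_of_mem_controlSet {E : Type*} [NormedAddCommGroup E] [NormedSpace ℝ E]
    {w : Fin M → ℝ} (hw : w ∈ controlSet M) (v : Fin M → E) :
    ‖∑ i, w i • v i‖ ≤ ∑ i, ‖v i‖ := by
  refine norm_sum_le_of_le _ fun i _ => ?_
  rw [norm_smul]
  exact mul_le_of_le_one_left (norm_nonneg _) (abs_le.2 ⟨(hw i).1, (hw i).2⟩)

lemma exists_eventually_norm_sub_le {F : EuclideanSpace ℝ (Fin N) → EuclideanSpace ℝ (Fin N)}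
    (hF : ContDiff ℝ 1 F) (x₀ : EuclideanSpace ℝ (Fin N)) :
    ∃ K : ℝ, 0 ≤ K ∧ ∀ᶠ x in 𝓝 x₀, ‖F x - F x₀‖ ≤ K * ‖x - x₀‖ := by
  obtain ⟨K, s, hs, hK⟩ := hF.contDiffAt.exists_lipschitzOnWith (x := x₀)
  refine ⟨K, K.2, ?_⟩
  filter_upwards [hs] with x hx
  exact hK.norm_sub_le hx (mem_of_mem_nhds hs)

lemma exists_hasLocalBounds_affineDynamics
    {F : EuclideanSpace ℝ (Fin N) → EuclideanSpace ℝ (Fin N)}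
    {g : Fin M → EuclideanSpace ℝ (Fin N) → EuclideanSpace ℝ (Fin N)}
    (hF : ContDiff ℝ 1 F) (hg : ∀ i, ContDiff ℝ 1 (g i)) (x₀ : EuclideanSpace ℝ (Fin N)) :
    ∃ δ C K : ℝ, HasLocalBounds (affineDynamics F g) x₀ δ C K := by
  obtain ⟨K₀, hK₀, hFK⟩ := exists_eventually_norm_sub_le hF x₀
  choose K₁ hK₁ hgK using fun i => exists_eventually_norm_sub_le (hg i) x₀
  obtain ⟨δ, hδ, hball⟩ := Metric.nhds_basis_closedBall.eventually_iff.1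
    (hFK.and (Filter.eventually_all.2 hgK))
  have hK : 0 ≤ K₀ + ∑ i, K₁ i := add_nonneg hK₀ (Finset.sum_nonneg fun i _ => hK₁ i)
  have hsub : ∀ x ∈ Metric.closedBall x₀ δ, ∀ w ∈ controlSet M,
      ‖affineDynamics F g x w - affineDynamics F g x₀ w‖ ≤ (K₀ + ∑ i, K₁ i) * ‖x - x₀‖ := by
    intro x hx w hw
    have : affineDynamics F g x w - affineDynamics F g x₀ w =
        (F x - F x₀) + ∑ i, w i • (g i x - g i x₀) := by
      simp only [affineDynamics, smul_sub, Finset.sum_sub_distrib]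
      abel
    rw [this, add_mul, Finset.sum_mul]
    refine (norm_add_le _ _).trans (add_le_add (hball hx).1 ?_)
    exact (norm_sum_smul_le_of_mem_controlSet hw _).trans
      (Finset.sum_le_sum fun i _ => (hball hx).2 i)
  -- The speed bound is the one at `x₀` plus the Lipschitz variation over the ball.
  refine ⟨δ, ‖F x₀‖ + ∑ i, ‖g i x₀‖ + (K₀ + ∑ i, K₁ i) * δ, K₀ + ∑ i, K₁ i, hδ,
    by positivity, hK, fun x hx w hw => ?_, hsub⟩
  have h1 : ‖affineDynamics F g x₀ w‖ ≤ ‖F x₀‖ + ∑ i, ‖g i x₀‖ :=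
    (norm_add_le _ _).trans (by gcongr; exact norm_sum_smul_le_of_mem_controlSet hw _)
  have h2 : (K₀ + ∑ i, K₁ i) * ‖x - x₀‖ ≤ (K₀ + ∑ i, K₁ i) * δ :=
    mul_le_mul_of_nonneg_left (mem_closedBall_iff_norm.1 hx) hK
  have h3 := norm_le_norm_add_norm_sub' (affineDynamics F g x w) (affineDynamics F g x₀ w)
  linarith [hsub x hx w hw]

theorem mem_horizonSubdifferential_minTime_affineDynamics_iff
    {F : EuclideanSpace ℝ (Fin N) → EuclideanSpace ℝ (Fin N)}
    {g : Fin M → EuclideanSpace ℝ (Fin N) → EuclideanSpace ℝ (Fin N)}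
    (hF : ContDiff ℝ 1 F) (hg : ∀ i, ContDiff ℝ 1 (g i)) (hx₀ : x₀ ≠ 0)
    (hT : minTime (affineDynamics F g) x₀ < ⊤) :
    ζ ∈ horizonSubdifferential (minTime (affineDynamics F g)) x₀ ↔
      minHamiltonian (affineDynamics F g) x₀ ζ = 0 ∧
      ζ ∈ proximalNormals
        (reachableSet (affineDynamics F g) (minTime (affineDynamics F g) x₀)) x₀ := by
  obtain ⟨δ, C, K, hb⟩ := exists_hasLocalBounds_affineDynamics hF hg x₀
  refine mem_horizonSubdifferential_minTime_iff hb (fun w _ => ?_) hx₀ hT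
  exact hF.add (ContDiff.sum fun i _ => (hg i).const_smul (w i))

/-- The columns of `B` serve as constant vector fields, so the affine result in any dimension covers
the linear case. -/
lemma linearDynamics_eq_affineDynamics (A : Matrix (Fin N) (Fin N) ℝ)
    (B : Matrix (Fin N) (Fin M) ℝ) :
    linearDynamics A B =
      affineDynamics (Matrix.toEuclideanCLM (𝕜 := ℝ) A) (fun i _ => WithLp.toLp 2 (B.col i)) := by
  funext x w
  ext j
  simp [linearDynamics, affineDynamics, Matrix.mulVec, dotProduct, mul_comm]

end MinTime

theorem proposition3p3 :
    -- linear systems in `ℝ ^ N`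
    (∀ (N M : ℕ) (A : Matrix (Fin N) (Fin N) ℝ) (B : Matrix (Fin N) (Fin M) ℝ)
      (xbar : EuclideanSpace ℝ (Fin N)) (D : Set (EuclideanSpace ℝ (Fin N)))
      (ζ : EuclideanSpace ℝ (Fin N)),
      xbar ≠ 0 →
      MinTime.minTime (MinTime.linearDynamics A B) xbar < ⊤ →
      D ∈ 𝓝 xbar →
      MinTime.HasLocallyPositiveReach
        (MinTime.epigraphOn D (MinTime.minTime (MinTime.linearDynamics A B))) →
      ζ ≠ 0 →
      (ζ ∈ MinTime.horizonSubdifferential (MinTime.minTime (MinTime.linearDynamics A B)) xbar ↔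
        MinTime.minHamiltonian (MinTime.linearDynamics A B) xbar ζ = 0 ∧
        ζ ∈ MinTime.proximalNormals
          (MinTime.reachableSet (MinTime.linearDynamics A B)
            (MinTime.minTime (MinTime.linearDynamics A B) xbar)) xbar)) ∧
    -- control-affine systems in the plane
    (∀ (M : ℕ) (F : EuclideanSpace ℝ (Fin 2) → EuclideanSpace ℝ (Fin 2))
      (g : Fin M → EuclideanSpace ℝ (Fin 2) → EuclideanSpace ℝ (Fin 2)) (L : ℝ≥0)
      (xbar : EuclideanSpace ℝ (Fin 2)) (D : Set (EuclideanSpace ℝ (Fin 2)))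
      (ζ : EuclideanSpace ℝ (Fin 2)),
      MinTime.IsC11 L F →
      (∀ i, MinTime.IsC11 L (g i)) →
      xbar ≠ 0 →
      MinTime.minTime (MinTime.affineDynamics F g) xbar < ⊤ →
      D ∈ 𝓝 xbar →
      MinTime.HasLocallyPositiveReach
        (MinTime.epigraphOn D (MinTime.minTime (MinTime.affineDynamics F g))) →
      ζ ≠ 0 →
      (ζ ∈ MinTime.horizonSubdifferential (MinTime.minTime (MinTime.affineDynamics F g)) xbar ↔
        MinTime.minHamiltonian (MinTime.affineDynamics F g) xbar ζ = 0 ∧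
        ζ ∈ MinTime.proximalNormals
          (MinTime.reachableSet (MinTime.affineDynamics F g)
            (MinTime.minTime (MinTime.affineDynamics F g) xbar)) xbar)) := by
  refine ⟨fun N M A B xbar D ζ hx hT _ _ _ => ?_, fun M F g L xbar D ζ hF hg hx hT _ _ _ => ?_⟩
  · rw [MinTime.linearDynamics_eq_affineDynamics] at hT ⊢
    exact MinTime.mem_horizonSubdifferential_minTime_affineDynamics_iff
      (ContinuousLinearMap.contDiff _) (fun _ => contDiff_const) hx hT
  · exact MinTime.mem_horizonSubdifferential_minTime_affineDynamics_iff hF.1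
      (fun i => (hg i).1) hx hT
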